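/- Fix a field $\mathbf k$ and an integer $n\ge 2$, and regard $\mathbb R^n$ with its product order as a category. An ($n$-parameter) persistence module is a functor $M:\mathbb R^n\to\mathbf{vec}$ to the category of finite dimensional $\mathbf k$-vector spaces. For $i\in\mathbb R^n$ let $\mathsf P_i$ be the module with value $\mathbf k$ at every $j\ge i$ and $0$ elsewhere, with identities as structure morphisms wherever possible; $M$ is finitely presentable if it is isomorphic to the cokernel of a morphism between finite direct sums of modules $\mathsf P_i$. $M$ is indecomposable if it is nonzero and not isomorphic to a direct sum of two nonzero persistence modules. For $\varepsilon\ge 0$ let $M[\varepsilon](a)=M(a+(\varepsilon,\dots,\varepsilon))$; $M$ and $N$ are $\varepsilon$-interleaved if there are morphisms $f:M\to N[\varepsilon]$ and $g:N\to M[\varepsilon]$ such that $g[\varepsilon]\circ f$ and $f[\varepsilon]\circ g$ are the morphisms $M\to M[2\varepsilon]$ and $N\to N[2\varepsilon]$ given by the structure morphisms. The interleaving distance $d_I(M,N)\in[0,\infty]$ is the infimum of the $\varepsilon\ge 0$ for which $M$ and $N$ are $\varepsilon$-interleaved. Equip the set of isomorphism classes of finitely presentable $n$-parameter persistence modules with the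 topology generated by the open balls of $d_I$. (1) Let $\mathcal F$ be a collection of isomorphism classes of indecomposable, finitely presentable $n$-parameter persistence modules, and call a finitely presentable module $\mathcal F$-decomposable if it is isomorphic to a direct sum of modules in $\mathcal F$. If $\mathcal F$ does not contain indecomposables of arbitrarily high pointwise dimension, that is, if there is $d\in\mathbb N$ such that $\dim_{\mathbf k} N(p)\le d$ for all $N\in\mathcal F$ and all $p\in\mathbb R^n$, then the set of $\mathcal F$-decomposable modules is nowhere dense (its closure has empty interior). (2) In particular, the set of finitely presentable modules that are spread decomposable (also called interval decomposable) is nowhere dense. Here a spread (or interval) is a nonempty subset $S\subseteq\mathbb R^n$ that is convex ($p\le q\le r$ and $p,r\in S$ imply $q\in S$) and connected (any two points of $S$ are joined by a finite zigzag of comparable points of $S$), and a module is spread decomposable if it is isomorphic to a direct sum of modules $\mathbf k_S$, where $S$ is a spread and $\mathbf k_S$ has value $\mathbf k$ on $S$ and $0$ elsewhere, with identity structure morphisms between points of $S$. -/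

import Mathlib

open CategoryTheory CategoryTheory.Limits
open scoped ENNReal NNReal

noncomputable section

universe u

/-- The poset `ℝⁿ` with the product order. It is a separate type so that, as a category, it has
a unique morphism `p ⟶ q` exactly when `p ≤ q` (and not the product category structure). -/
def RPoset (n : ℕ) : Type := Fin n → ℝ

instance (n : ℕ) : PartialOrder (RPoset n) := inferInstanceAs (PartialOrder (Fin n → ℝ))

/-- An `n`-parameter (pointwise finite dimensional) persistence module over the field `k`: a functor
from the poset `ℝⁿ` (product order) to the category of finite dimensional `k`-vector spaces. -/
abbrev PersMod (k : Type u) [Field k] (n : ℕ) : Type (u + 1) :=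
  RPoset n ⥤ FGModuleCat.{u} k

instance (k : Type u) [Field k] (n : ℕ) : HasFiniteBiproducts (PersMod k n) :=
  Abelian.hasFiniteBiproducts

namespace PersMod

variable {k : Type u} [Field k] {n : ℕ}

/-- The point `a + (r, …, r)`. -/
def diag (r : ℝ≥0) (a : RPoset n) : RPoset n := fun i => a i + r

theorem le_diag (r : ℝ≥0) (a : RPoset n) : a ≤ diag r a :=
  fun _ => le_add_of_nonneg_right r.2

theorem diag_mono (r : ℝ≥0) : Monotone (diag (n := n) r) :=
  fun _ _ h i => add_le_add_left (h i) (r : ℝ)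

/-- The functor `ℝⁿ ⥤ ℝⁿ` given by `a ↦ a + (r, …, r)`. -/
def diagFunctor (n : ℕ) (r : ℝ≥0) : RPoset n ⥤ RPoset n := (diag_mono r).functor

/-- The `r`-shift `M[r]` of `M`, with `M[r](a) = M(a + r)`. -/
abbrev shift (r : ℝ≥0) (M : PersMod k n) : PersMod k n := diagFunctor n r ⋙ M

/-- The morphism of functors `id ⟶ (a ↦ (a + r) + r)`. -/
def diagTwice (n : ℕ) (r : ℝ≥0) : 𝟭 (RPoset n) ⟶ diagFunctor n r ⋙ diagFunctor n r where
  app a := homOfLE ((le_diag r a).trans (le_diag r (diag r a)))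
  naturality _ _ _ := Subsingleton.elim _ _

/-- The canonical morphism `M ⟶ M[2r] = M[r][r]` given by the structure morphisms
`M(a) ⟶ M((a + r) + r)`. -/
def toShiftTwice (r : ℝ≥0) (M : PersMod k n) : M ⟶ shift r (shift r M) where
  app a := M.map ((diagTwice n r).app a)
  naturality a b f := by
    simp only [Functor.comp_map, ← M.map_comp]
    rfl

/-- `M` and `N` are `ε`-interleaved: there are morphisms `f : M ⟶ N[ε]` and `g : N ⟶ M[ε]` such
that `g[ε] ∘ f` and `f[ε] ∘ g` are the canonical morphisms `M ⟶ M[2ε]` and `N ⟶ N[2ε]`. -/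
def Interleaved (ε : ℝ≥0) (M N : PersMod k n) : Prop :=
  ∃ (f : M ⟶ shift ε N) (g : N ⟶ shift ε M),
    f ≫ Functor.whiskerLeft (diagFunctor n ε) g = toShiftTwice ε M ∧
    g ≫ Functor.whiskerLeft (diagFunctor n ε) f = toShiftTwice ε N

/-- The interleaving distance (the infimum of the empty set is `∞`). -/
def interleavingDist (M N : PersMod k n) : ℝ≥0∞ :=
  ⨅ (ε : ℝ≥0) (_ : Interleaved ε M N), (ε : ℝ≥0∞)

theorem Interleaved.of_iso {ε : ℝ≥0} {M M' N N' : PersMod k n} (e : M ≅ M') (e' : N ≅ N')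
    (h : Interleaved ε M N) : Interleaved ε M' N' := by
  obtain ⟨f, g, hfg, hgf⟩ := h
  refine ⟨e.inv ≫ f ≫ Functor.whiskerLeft _ e'.hom, e'.inv ≫ g ≫ Functor.whiskerLeft _ e.hom,
    ?_, ?_⟩
  · ext1; funext a
    have h := congrArg (fun t => t.app a) hfg
    simp only [NatTrans.comp_app, Functor.whiskerLeft_app, toShiftTwice] at h
    simp only [NatTrans.comp_app, Functor.whiskerLeft_app, Category.assoc,
      Iso.hom_inv_id_app_assoc, toShiftTwice]
    rw [reassoc_of% h]
    erw [e.hom.naturality]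
    simp
  · ext1; funext a
    have h := congrArg (fun t => t.app a) hgf
    simp only [NatTrans.comp_app, Functor.whiskerLeft_app, toShiftTwice] at h
    simp only [NatTrans.comp_app, Functor.whiskerLeft_app, Category.assoc,
      Iso.hom_inv_id_app_assoc, toShiftTwice]
    rw [reassoc_of% h]
    erw [e'.hom.naturality]
    simp

theorem interleavingDist_congr {M M' N N' : PersMod k n} (e : M ≅ M') (e' : N ≅ N') :
    interleavingDist M N = interleavingDist M' N' := by
  have : ∀ ε : ℝ≥0, Interleaved ε M N ↔ Interleaved ε M' N' := fun ε =>
    ⟨Interleaved.of_iso e e', Interleaved.of_iso e.symm e'.symm⟩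
  simp only [interleavingDist, this]

/-- The value at `p` of the indicator module of `S`: the line `k` if `p ∈ S`, and `0` otherwise. -/
def indicatorValue (k : Type u) [Field k] (S : Set (RPoset n)) (p : RPoset n) : Submodule k k where
  carrier := {x | p ∉ S → x = 0}
  add_mem' hx hy h := by rw [hx h, hy h, add_zero]
  zero_mem' _ := rfl
  smul_mem' c x hx h := by rw [hx h, smul_zero]

open scoped Classical in
/-- The identity of `k` when both points lie in `S`, and zero otherwise. -/
def indicatorMap (k : Type u) [Field k] (S : Set (RPoset n)) (p q : RPoset n) :
    indicatorValue k S p →ₗ[k] indicatorValue k S q where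
  toFun x := ⟨if q ∈ S then x.1 else 0, fun h => if_neg h⟩
  map_add' x y := Subtype.ext (by by_cases h : q ∈ S <;> simp [h])
  map_smul' c x := Subtype.ext (by by_cases h : q ∈ S <;> simp [h])

theorem indicatorMap_self (k : Type u) [Field k] (S : Set (RPoset n)) (p : RPoset n) :
    indicatorMap k S p p = LinearMap.id := by
  refine LinearMap.ext fun x => Subtype.ext ?_
  by_cases h : p ∈ S
  · simp [indicatorMap, h]
  · simp [indicatorMap, h, x.2 h]

theorem indicatorMap_comp (k : Type u) [Field k] (S : Set (RPoset n)) (hS : S.OrdConnected)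
    {p q r : RPoset n} (hpq : p ≤ q) (hqr : q ≤ r) :
    indicatorMap k S p r = (indicatorMap k S q r).comp (indicatorMap k S p q) := by
  refine LinearMap.ext fun x => Subtype.ext ?_
  by_cases hr : r ∈ S
  · by_cases hp : p ∈ S
    · have hq : q ∈ S := hS.out hp hr ⟨hpq, hqr⟩
      simp [indicatorMap, hr, hq]
    · simp [indicatorMap, x.2 hp]
  · simp [indicatorMap, hr]

/-- For a convex subset `S` of the poset `ℝⁿ`, the module with value `k` on `S` and `0` elsewhere,
all structure morphisms between points of `S` being identities. -/
def indicatorModule (k : Type u) [Field k] (S : Set (RPoset n)) (hS : S.OrdConnected) :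
    PersMod k n where
  obj p := FGModuleCat.of k (indicatorValue k S p)
  map {p q} _ := FGModuleCat.ofHom (indicatorMap k S p q)
  map_id p := by
    rw [indicatorMap_self]
    rfl
  map_comp f g := by
    rw [indicatorMap_comp k S hS (leOfHom f) (leOfHom g)]
    rfl

/-- The module `P_i`, with value `k` at all `j ≥ i` and `0` elsewhere. -/
def free (k : Type u) [Field k] (i : RPoset n) : PersMod k n :=
  indicatorModule k (Set.Ici i) Set.ordConnected_Ici

/-- `M` is isomorphic to the cokernel of a morphism `⨁ⱼ P_{b j} ⟶ ⨁ᵢ P_{a i}` between finite direct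
sums. -/
def IsFinPres (M : PersMod k n) : Prop :=
  ∃ (s t : ℕ) (a : Fin s → RPoset n) (b : Fin t → RPoset n)
    (f : (⨁ fun j => free k (b j)) ⟶ ⨁ fun i => free k (a i)), Nonempty (M ≅ cokernel f)

open scoped Classical in
/-- `M` is isomorphic to the direct sum of the family `X` (possibly infinite or empty): there are
morphisms `X j ⟶ M` that identify every `M(p)` with the direct sum of the spaces `X j (p)`. -/
def IsDirectSumOf {J : Type*} (X : J → PersMod k n) (M : PersMod k n) : Prop :=
  ∃ i : ∀ j, X j ⟶ M, ∀ p : RPoset n,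
    Function.Bijective
      (DirectSum.toModule k J (M.obj p) fun j => ((i j).app p).hom.hom)

/-- A spread (also called an interval) of the poset `ℝⁿ`: a convex subset that is connected
(in particular nonempty) as a poset, that is, any two of its points are joined by a zigzag of
comparable points of the subset. -/
structure IsSpread (S : Set (RPoset n)) : Prop where
  convex : S.OrdConnected
  connected : CategoryTheory.IsConnected S

/-- `M` is spread decomposable (interval decomposable): a direct sum of indicator modules of
spreads. -/
def SpreadDecomposable (M : PersMod k n) : Prop :=
  ∃ (J : Type) (S : J → Set (RPoset n)) (hS : ∀ j, IsSpread (S j)),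
    IsDirectSumOf (fun j => indicatorModule k (S j) (hS j).convex) M

end PersMod

/-- Finitely presentable `n`-parameter persistence modules. -/
abbrev FPMod (k : Type u) [Field k] (n : ℕ) : Type (u + 1) :=
  {M : PersMod k n // M.IsFinPres}

/-- Isomorphism of finitely presentable persistence modules. -/
instance FPMod.setoid (k : Type u) [Field k] (n : ℕ) : Setoid (FPMod k n) where
  r M N := Nonempty (M.1 ≅ N.1)
  iseqv := ⟨fun _ => ⟨Iso.refl _⟩, fun ⟨e⟩ => ⟨e.symm⟩, fun ⟨e⟩ ⟨e'⟩ => ⟨e.trans e'⟩⟩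

/-- The set of isomorphism classes of finitely presentable `n`-parameter persistence modules. -/
def FPSpace (k : Type u) [Field k] (n : ℕ) : Type (u + 1) := Quotient (FPMod.setoid k n)

namespace FPSpace

variable {k : Type u} [Field k] {n : ℕ}

/-- The isomorphism class of `M`. -/
def mk (M : FPMod k n) : FPSpace k n := Quotient.mk _ M

/-- The interleaving distance between isomorphism classes. -/
def dist (x y : FPSpace k n) : ℝ≥0∞ :=
  Quotient.liftOn₂ x y (fun M N => PersMod.interleavingDist M.1 N.1)
    fun _ _ _ _ ⟨e⟩ ⟨e'⟩ => PersMod.interleavingDist_congr e e'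

/-- The topology generated by the open balls of the interleaving distance. -/
instance : TopologicalSpace (FPSpace k n) :=
  TopologicalSpace.generateFrom
    {B | ∃ (x : FPSpace k n) (ε : ℝ), 0 < ε ∧ B = {y | dist x y < ENNReal.ofReal ε}}

/-- Every class in `F` consists of indecomposable modules: nonzero modules that are not isomorphic
to a direct sum of two nonzero (pointwise finite dimensional) modules. -/
def AllIndecomposable (F : Set (FPSpace k n)) : Prop :=
  ∀ M : FPMod k n, mk M ∈ F → Indecomposable M.1

/-- `F` contains modules of arbitrarily high pointwise dimension. -/
def HasArbitrarilyHighPointwiseDim (F : Set (FPSpace k n)) : Prop :=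
  ∀ d : ℕ, ∃ M : FPMod k n, mk M ∈ F ∧ ∃ p : RPoset n, d ≤ Module.finrank k (M.1.obj p)

/-- The set of `F`-decomposable classes: those of the finitely presentable modules that are direct
sums of modules in `F`. -/
def decomposables (F : Set (FPSpace k n)) : Set (FPSpace k n) :=
  {x | ∃ M : FPMod k n, mk M = x ∧
    ∃ (J : Type) (X : J → FPMod k n), (∀ j, mk (X j) ∈ F) ∧
      PersMod.IsDirectSumOf (fun j => (X j).1) M.1}

/-- The set of classes of spread decomposable finitely presentable modules. -/
def spreadDecomposables (k : Type u) [Field k] (n : ℕ) : Set (FPSpace k n) :=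
  {x | ∃ M : FPMod k n, mk M = x ∧ M.1.SpreadDecomposable}

end FPSpace

end

/-! Every finitely presentable `M` can be perturbed slightly so that any module near the result
needs a direct summand of large pointwise dimension. The perturbation adds a small rigid module `W`
(`exists_small_rigid`). It has generators `g_0, …, g_m` on an antichain, available since `n ≥ 2`,
one relation `∑ g_i = 0` at a common upper bound `p`, and every `g_i` dies at a point `y` not far
above, so `M ⊞ W` is close to `M`. A morphism from `W` to a small shift must send each `g_i` to a
multiple `c_i g_i`, because no other generator lives there. As `∑ g_i = 0` is the only relation near
`p`, all `c_i` agree, and the morphism acts at `p` as a scalar times the structure map.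

Suppose `L` is very close to `M ⊞ W` and is a direct sum of modules `X j`. The composites `W → L → X
j → L → W`, up to shift, act at `p` as scalars `c j`, and they sum to the structure map, which is
nonzero at `p`. So some `c j ≠ 0`, and `X j` contains a copy of an `m`-dimensional subspace of
`W(p)`. With `m = d + 1` this excludes summands of pointwise dimension at most `d`
(`exists_near_not_isDirectSumOf`). Spreads are the case `d = 1`. -/

noncomputable section

universe u

/-! ### Elementwise calculus of persistence modules -/

namespace PersMod

variable {k : Type u} [Field k] {n : ℕ}

/-- The linear map `M(a) → N(a)` given by a morphism of persistence modules. -/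
def ev {M N : PersMod k n} (f : M ⟶ N) (a : RPoset n) : M.obj a →ₗ[k] N.obj a :=
  (f.app a).hom.hom

/-- The structure map `M(a) → M(b)`. -/
def str (M : PersMod k n) {a b : RPoset n} (h : a ≤ b) : M.obj a →ₗ[k] M.obj b :=
  (M.map (homOfLE h)).hom.hom

theorem str_self (M : PersMod k n) {a : RPoset n} (h : a ≤ a) (x : M.obj a) :
    str M h x = x := by
  have : M.map (homOfLE h) = 𝟙 _ := M.map_id a
  rw [str, this]
  rfl

theorem str_str (M : PersMod k n) {a b c : RPoset n} (h : a ≤ b) (h' : b ≤ c) (x : M.obj a) :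
    str M h' (str M h x) = str M (h.trans h') x := by
  have : M.map (homOfLE (h.trans h')) = M.map (homOfLE h) ≫ M.map (homOfLE h') :=
    M.map_comp (homOfLE h) (homOfLE h')
  rw [str, str, str, this]
  rfl

theorem ev_comp {M N L : PersMod k n} (f : M ⟶ N) (g : N ⟶ L) (a : RPoset n) (x : M.obj a) :
    ev (f ≫ g) a x = ev g a (ev f a x) := rfl

theorem ev_id (M : PersMod k n) (a : RPoset n) (x : M.obj a) : ev (𝟙 M) a x = x := rfl

theorem ev_zero (M N : PersMod k n) (a : RPoset n) (x : M.obj a) :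
    ev (0 : M ⟶ N) a x = 0 := rfl

theorem ev_add {M N : PersMod k n} (f g : M ⟶ N) (a : RPoset n) (x : M.obj a) :
    ev (f + g) a x = ev f a x + ev g a x := rfl

theorem ev_sum {M N : PersMod k n} {J : Type*} (s : Finset J) (f : J → (M ⟶ N)) (a : RPoset n)
    (x : M.obj a) : ev (∑ j ∈ s, f j) a x = ∑ j ∈ s, ev (f j) a x := by
  classical
  induction s using Finset.induction_on with
  | empty => simp [ev_zero]
  | insert j s hj ih => rw [Finset.sum_insert hj, Finset.sum_insert hj, ev_add, ih]

theorem ev_str {M N : PersMod k n} (f : M ⟶ N) {a b : RPoset n} (h : a ≤ b) (x : M.obj a) :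
    ev f b (str M h x) = str N h (ev f a x) := by
  have := congrArg (fun t => t.hom.hom x) (f.naturality (homOfLE h))
  exact this

theorem hom_ext_ev {M N : PersMod k n} {f g : M ⟶ N} (h : ∀ a x, ev f a x = ev g a x) :
    f = g := by
  ext1; funext a
  exact FGModuleCat.hom_ext (LinearMap.ext (h a))

/-- A morphism of persistence modules given by linear maps. -/
def homMk {M N : PersMod k n} (φ : ∀ a, M.obj a →ₗ[k] N.obj a)
    (h : ∀ a b (hab : a ≤ b) x, φ b (str M hab x) = str N hab (φ a x)) : M ⟶ N where
  app a := ObjectProperty.homMk (ModuleCat.ofHom (φ a))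
  naturality a b f := FGModuleCat.hom_ext (LinearMap.ext fun x => h a b (leOfHom f) x)

theorem ev_homMk {M N : PersMod k n} (φ : ∀ a, M.obj a →ₗ[k] N.obj a)
    (h : ∀ a b (hab : a ≤ b) x, φ b (str M hab x) = str N hab (φ a x)) (a : RPoset n)
    (x : M.obj a) : ev (homMk φ h) a x = φ a x := rfl

theorem ev_surjective {M N : PersMod k n} (f : M ⟶ N) [Epi f] (a : RPoset n) :
    Function.Surjective (ev f a) := by
  have h1 : Epi (f.app a) := inferInstance
  have h2 : Epi ((forget₂ (FGModuleCat.{u} k) (ModuleCat.{u} k)).map (f.app a)) := inferInstance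
  exact (ModuleCat.epi_iff_surjective _).1 h2

open scoped Classical in
/-- The image in `M(b)` of an element of `M(a)`, or zero if `a ≤ b` does not hold. -/
def push (M : PersMod k n) {a : RPoset n} (b : RPoset n) : M.obj a →ₗ[k] M.obj b :=
  if h : a ≤ b then str M h else 0

theorem push_of_le (M : PersMod k n) {a b : RPoset n} (h : a ≤ b) (x : M.obj a) :
    push M b x = str M h x := by
  simp [push, h]

theorem push_of_not_le (M : PersMod k n) {a b : RPoset n} (h : ¬ a ≤ b) (x : M.obj a) :
    push M b x = 0 := by
  simp [push, h]

theorem ev_push {M N : PersMod k n} (f : M ⟶ N) {a : RPoset n} (b : RPoset n) (x : M.obj a) :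
    ev f b (push M b x) = push N b (ev f a x) := by
  by_cases h : a ≤ b
  · rw [push_of_le M h, push_of_le N h, ev_str]
  · rw [push_of_not_le M h, push_of_not_le N h, map_zero]

/-! ### Free modules, generators and relations -/

/-- The generator of the free module `P_i`. -/
def freeGen (k : Type u) [Field k] (i : RPoset n) : (free k i).obj i :=
  (⟨1, fun h => (h (Set.mem_Ici.2 le_rfl)).elim⟩ : indicatorValue k (Set.Ici i) i)

/-- The underlying scalar of an element of an indicator module. -/
def indVal {S : Set (RPoset n)} {hS : S.OrdConnected} {a : RPoset n} :
    (indicatorModule k S hS).obj a →ₗ[k] k := (indicatorValue k S a).subtype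

theorem indVal_injective {S : Set (RPoset n)} {hS : S.OrdConnected} {a : RPoset n}
    {x y : (indicatorModule k S hS).obj a} (h : indVal x = indVal y) : x = y := Subtype.ext h

theorem indVal_eq_zero {S : Set (RPoset n)} {hS : S.OrdConnected} {a : RPoset n}
    (ha : a ∉ S) (x : (indicatorModule k S hS).obj a) : indVal x = 0 := Subtype.prop x ha

theorem indVal_str {S : Set (RPoset n)} {hS : S.OrdConnected} {a b : RPoset n} (h : a ≤ b)
    (hb : b ∈ S) (x : (indicatorModule k S hS).obj a) :
    indVal (str (indicatorModule k S hS) h x) = indVal x := if_pos hb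

/-- The underlying scalar of an element of a free module. -/
def freeVal {i a : RPoset n} : (free k i).obj a →ₗ[k] k :=
  indVal (hS := Set.ordConnected_Ici)

theorem freeVal_freeGen (i : RPoset n) : freeVal (freeGen k i) = 1 := rfl

theorem freeVal_eq_zero {i a : RPoset n} (h : ¬ i ≤ a) (x : (free k i).obj a) : freeVal x = 0 :=
  indVal_eq_zero (hS := Set.ordConnected_Ici) (mt Set.mem_Ici.1 h) x

theorem freeVal_str {i a b : RPoset n} (h : a ≤ b) (hb : i ≤ b) (x : (free k i).obj a) :
    freeVal (str (free k i) h x) = freeVal x :=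
  indVal_str (hS := Set.ordConnected_Ici) h (Set.mem_Ici.2 hb) x

theorem free_eq_smul {i a : RPoset n} (x : (free k i).obj a) :
    x = freeVal x • push (free k i) a (freeGen k i) := by
  refine indVal_injective (hS := Set.ordConnected_Ici) ?_
  change freeVal x = freeVal _
  rw [map_smul]
  by_cases h : i ≤ a
  · rw [push_of_le _ h, freeVal_str h h, freeVal_freeGen, smul_eq_mul, mul_one]
  · rw [freeVal_eq_zero h, zero_smul]

/-- The morphism `P_i ⟶ N` that sends the generator to a given element of `N(i)`. -/
def freeDesc {N : PersMod k n} {i : RPoset n} (v : N.obj i) : free k i ⟶ N :=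
  homMk (fun a => LinearMap.toSpanSingleton k _ (push N a v) ∘ₗ freeVal) fun a b hab x => by
    simp only [LinearMap.comp_apply, LinearMap.toSpanSingleton_apply, map_smul]
    by_cases h : i ≤ a
    · rw [freeVal_str hab (h.trans hab), push_of_le N h, str_str, push_of_le N (h.trans hab)]
    · rw [free_eq_smul x, push_of_not_le _ h]
      simp

theorem ev_freeDesc {N : PersMod k n} {i : RPoset n} (v : N.obj i) :
    ev (freeDesc v) i (freeGen k i) = v := by
  rw [freeDesc, ev_homMk]
  simp only [LinearMap.comp_apply, LinearMap.toSpanSingleton_apply, freeVal_freeGen, one_smul]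
  rw [push_of_le N le_rfl, str_self]

theorem free_hom_ext {N : PersMod k n} {i : RPoset n} {f g : free k i ⟶ N}
    (h : ev f i (freeGen k i) = ev g i (freeGen k i)) : f = g := by
  refine hom_ext_ev fun a x => ?_
  rw [free_eq_smul x, map_smul, map_smul, ev_push, ev_push, h]

/-- Finitely presentable modules are given by generators and relations. -/
theorem exists_isFinPres_of_relations {s t : ℕ} (a : Fin s → RPoset n) (b : Fin t → RPoset n)
    (r : Fin t → Fin s → k) :
    ∃ (W : PersMod k n) (g : ∀ i, W.obj (a i)), W.IsFinPres ∧
      (∀ p (w : W.obj p), ∃ c : Fin s → k, w = ∑ i, c i • push W p (g i)) ∧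
      (∀ j, ∑ i, r j i • push W (b j) (g i) = 0) ∧
      ∀ (N : PersMod k n) (v : ∀ i, N.obj (a i)),
        (∀ j, ∑ i, r j i • push N (b j) (v i) = 0) → ∃ h : W ⟶ N, ∀ i, ev h (a i) (g i) = v i := by
  let A := ⨁ fun i => free k (a i)
  let e : ∀ i, A.obj (a i) := fun i => ev (biproduct.ι (fun i => free k (a i)) i) _ (freeGen k _)
  let f : (⨁ fun j => free k (b j)) ⟶ A :=
    biproduct.desc fun j => freeDesc (∑ i, r j i • push A (b j) (e i))
  have hf : ∀ j, biproduct.ι (fun j => free k (b j)) j ≫ f =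
      freeDesc (∑ i, r j i • push A (b j) (e i)) := fun j => biproduct.ι_desc _ _
  have hA : ∀ p (x : A.obj p), ∃ c : Fin s → k, x = ∑ i, c i • push A p (e i) := by
    intro p x
    -- The coefficients of `x` are the scalars of its projections to the free summands.
    refine ⟨fun i => freeVal (ev (biproduct.π (fun i => free k (a i)) i) p x), ?_⟩
    have h := congrArg (fun t => ev t p x) (biproduct.total (f := fun i => free k (a i)))
    simp only [ev_sum, ev_comp] at h
    refine h.symm.trans (Finset.sum_congr rfl fun i _ => ?_)
    rw [free_eq_smul (ev (biproduct.π (fun i => free k (a i)) i) p x), map_smul, ev_push]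
  refine ⟨cokernel f, fun i => ev (cokernel.π f) _ (e i), ⟨s, t, a, b, f, ⟨Iso.refl _⟩⟩, ?_, ?_, ?_⟩
  · intro p w
    obtain ⟨x, rfl⟩ := ev_surjective (cokernel.π f) p w
    obtain ⟨c, rfl⟩ := hA p x
    exact ⟨c, by simp [ev_push]⟩
  · intro j
    have h := congrArg (fun t => ev (biproduct.ι (fun j => free k (b j)) j ≫ t) (b j)
      (freeGen k (b j))) (cokernel.condition f)
    simp only [comp_zero, ev_zero, ← Category.assoc, hf] at h
    rw [ev_comp, ev_freeDesc] at h
    simpa [ev_push] using h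
  · intro N v hv
    let h : A ⟶ N := biproduct.desc fun i => freeDesc (v i)
    have he : ∀ i, ev h (a i) (e i) = v i := fun i => by
      rw [← ev_comp, biproduct.ι_desc, ev_freeDesc]
    refine ⟨cokernel.desc f h ?_, fun i => ?_⟩
    · refine biproduct.hom_ext' _ _ fun j => ?_
      rw [← Category.assoc, hf]
      apply free_hom_ext
      rw [ev_comp, ev_freeDesc, comp_zero, ev_zero]
      simpa [ev_push, he] using hv j
    · rw [← ev_comp, cokernel.π_desc, he]

end PersMod

/-! ### Biproducts and finite presentability -/

section Biproducts

variable {C : Type*} [Category C] [Abelian C] [HasFiniteBiproducts C]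

/-- A biproduct over a sum type is the biproduct of the two partial biproducts. -/
def biproductSumIso {I J : Type} [Finite I] [Finite J] (F : I ⊕ J → C) :
    ⨁ F ≅ (⨁ fun i => F (Sum.inl i)) ⊞ (⨁ fun j => F (Sum.inr j)) where
  hom := biproduct.desc fun x => match x with
    | Sum.inl i => biproduct.ι (fun i => F (Sum.inl i)) i ≫ biprod.inl
    | Sum.inr j => biproduct.ι (fun j => F (Sum.inr j)) j ≫ biprod.inr
  inv := biprod.desc (biproduct.desc fun i => biproduct.ι F (Sum.inl i))
    (biproduct.desc fun j => biproduct.ι F (Sum.inr j))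
  hom_inv_id := by
    refine biproduct.hom_ext' _ _ fun x => ?_
    rcases x with i | j <;> simp
  inv_hom_id := by
    ext <;> simp

/-- The cokernel of a biproduct of two morphisms is the biproduct of the cokernels. -/
def cokernelBiprodMapIso {A B A' B' : C} (f : A ⟶ B) (g : A' ⟶ B') :
    cokernel (biprod.map f g) ≅ cokernel f ⊞ cokernel g where
  hom := cokernel.desc _ (biprod.map (cokernel.π f) (cokernel.π g)) (by ext <;> simp)
  inv := biprod.desc
    (cokernel.desc f (biprod.inl ≫ cokernel.π (biprod.map f g)) (by
      rw [← biprod.inl_map_assoc, cokernel.condition, comp_zero]))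
    (cokernel.desc g (biprod.inr ≫ cokernel.π (biprod.map f g)) (by
      rw [← biprod.inr_map_assoc, cokernel.condition, comp_zero]))
  hom_inv_id := by
    apply coequalizer.hom_ext
    ext <;> simp
  inv_hom_id := by
    ext <;> simp

end Biproducts

namespace PersMod

variable {k : Type u} [Field k] {n : ℕ}

theorem IsFinPres.biprod {M N : PersMod k n} (hM : M.IsFinPres) (hN : N.IsFinPres) :
    (M ⊞ N).IsFinPres := by
  obtain ⟨s, t, a, b, f, ⟨e⟩⟩ := hM
  obtain ⟨s', t', a', b', g, ⟨e'⟩⟩ := hN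
  -- Concatenating two lists of degrees gives the biproduct of the two free modules.
  have key : ∀ {s s' : ℕ} (a : Fin s → RPoset n) (a' : Fin s' → RPoset n),
      Nonempty ((⨁ fun i => free k ((Sum.elim a a' ∘ finSumFinEquiv.symm) i)) ≅
        (⨁ fun i => free k (a i)) ⊞ (⨁ fun i => free k (a' i))) := fun {s s'} a a' =>
    ⟨(biproduct.reindex finSumFinEquiv.symm (fun i => free k (Sum.elim a a' i))).trans
      (biproductSumIso fun i => free k (Sum.elim a a' i))⟩
  obtain ⟨e₁⟩ := key a a'
  obtain ⟨e₂⟩ := key b b'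
  refine ⟨s + s', t + t', _, _, e₂.hom ≫ biprod.map f g ≫ e₁.inv,
    ⟨(biprod.mapIso e e').trans ((cokernelBiprodMapIso f g).symm.trans ?_)⟩⟩
  exact cokernel.mapIso _ _ e₂.symm e₁.symm (by simp)

/-! ### Interleavings and the interleaving distance -/

theorem le_diag_diag (r : ℝ≥0) (a : RPoset n) : a ≤ diag r (diag r a) :=
  (le_diag r a).trans (le_diag r _)

theorem diag_diag_mono (r : ℝ≥0) {a b : RPoset n} (h : a ≤ b) :
    diag r (diag r a) ≤ diag r (diag r b) :=
  diag_mono r (diag_mono r h)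

/-- Interleavings in terms of families of linear maps. -/
theorem interleaved_iff {ε : ℝ≥0} {M N : PersMod k n} :
    Interleaved ε M N ↔
      ∃ (f : ∀ a, M.obj a →ₗ[k] N.obj (diag ε a)) (g : ∀ a, N.obj a →ₗ[k] M.obj (diag ε a)),
        (∀ a b (h : a ≤ b) x, f b (str M h x) = str N (diag_mono ε h) (f a x)) ∧
        (∀ a b (h : a ≤ b) x, g b (str N h x) = str M (diag_mono ε h) (g a x)) ∧
        (∀ a x, g (diag ε a) (f a x) = str M (le_diag_diag ε a) x) ∧
        (∀ a x, f (diag ε a) (g a x) = str N (le_diag_diag ε a) x) := by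
  constructor
  · rintro ⟨f, g, hfg, hgf⟩
    exact ⟨ev f, ev g, fun a b h x => ev_str f h x, fun a b h x => ev_str g h x,
      fun a x => congrArg (fun t => ev t a x) hfg, fun a x => congrArg (fun t => ev t a x) hgf⟩
  · rintro ⟨f, g, hf, hg, hfg, hgf⟩
    exact ⟨homMk (N := shift ε N) f hf, homMk (N := shift ε M) g hg,
      hom_ext_ev fun a x => hfg a x, hom_ext_ev fun a x => hgf a x⟩

theorem diag_diag (r r' : ℝ≥0) (a : RPoset n) : diag r' (diag r a) = diag (r + r') a := by
  funext i
  simp [diag, add_assoc]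

theorem Interleaved.refl (M : PersMod k n) : Interleaved 0 M M :=
  interleaved_iff.2 ⟨fun a => str M (le_diag 0 a), fun a => str M (le_diag 0 a),
    fun _ _ _ _ => by rw [str_str, str_str], fun _ _ _ _ => by rw [str_str, str_str],
    fun _ _ => by rw [str_str], fun _ _ => by rw [str_str]⟩

theorem Interleaved.trans {r r' : ℝ≥0} {M N L : PersMod k n} (h : Interleaved r M N)
    (h' : Interleaved r' N L) : Interleaved (r + r') M L := by
  obtain ⟨f, g, hf, hg, hfg, hgf⟩ := interleaved_iff.1 h
  obtain ⟨f', g', hf', hg', hfg', hgf'⟩ := interleaved_iff.1 h'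
  have h₁ : ∀ a : RPoset n, diag r' (diag r a) ≤ diag (r + r') a := fun a => (diag_diag r r' a).le
  have h₂ : ∀ a : RPoset n, diag r (diag r' a) ≤ diag (r + r') a := fun a => by
    rw [diag_diag, add_comm]
  refine interleaved_iff.2 ⟨fun a => str L (h₁ a) ∘ₗ f' (diag r a) ∘ₗ f a,
    fun a => str M (h₂ a) ∘ₗ g (diag r' a) ∘ₗ g' a, ?_, ?_, ?_, ?_⟩ <;>
  intros <;>
  simp only [LinearMap.comp_apply, hf, hg, hf', hg', hfg, hgf, hfg', hgf', str_str]

/-- Inclusion and projection, each followed by a shift by `s`, interleave: the round trip on `M ⊞ W`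
loses only the `W`-component, which the structure map of length `2s` kills anyway. -/
theorem Interleaved.biprod_of_str_eq_zero {s : ℝ≥0} (M : PersMod k n) {W : PersMod k n}
    (hW : ∀ a (w : W.obj a), str W (le_diag_diag s a) w = 0) : Interleaved s M (M ⊞ W) := by
  refine interleaved_iff.2 ⟨fun a => ev biprod.inl _ ∘ₗ str M (le_diag s a),
    fun a => ev biprod.fst _ ∘ₗ str (M ⊞ W) (le_diag s a), ?_, ?_, ?_, ?_⟩
  · intro a b h x
    simp only [LinearMap.comp_apply, ← ev_str, str_str]
  · intro a b h x
    simp only [LinearMap.comp_apply, ← ev_str, str_str]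
  · intro a x
    simp only [LinearMap.comp_apply, ← ev_str, str_str]
    rw [← ev_comp, biprod.inl_fst, ev_id]
  · intro a x
    simp only [LinearMap.comp_apply, ← ev_str, str_str]
    have h := congrArg (fun t => ev t _ (str (M ⊞ W) (le_diag_diag s a) x))
      (biprod.total (X := M) (Y := W))
    simp only [ev_add, ev_comp] at h
    rw [ev_str biprod.snd, hW, map_zero, add_zero] at h
    exact h

theorem interleavingDist_self (M : PersMod k n) : interleavingDist M M = 0 :=
  le_antisymm (iInf₂_le_of_le 0 (Interleaved.refl M) (by simp)) zero_le

theorem interleavingDist_triangle (M N L : PersMod k n) :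
    interleavingDist M L ≤ interleavingDist M N + interleavingDist N L := by
  refine ENNReal.le_iInf₂_add_iInf₂ fun r hr r' hr' => ?_
  exact iInf₂_le_of_le (r + r') (hr.trans hr') (by simp)

theorem exists_interleaved_of_dist_lt {M N : PersMod k n} {δ : ℝ≥0}
    (h : interleavingDist M N < δ) : ∃ t < δ, Interleaved t M N := by
  obtain ⟨t, ht, hlt⟩ := by simpa only [interleavingDist, iInf_lt_iff] using h
  exact ⟨t, by exact_mod_cast hlt, ht⟩

/-! ### Projections of possibly infinite direct sums -/

open scoped Classical in
/-- The projections of a direct sum. -/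
theorem IsDirectSumOf.exists_proj {J : Type*} {X : J → PersMod k n} {M : PersMod k n}
    (h : IsDirectSumOf X M) :
    ∃ (i : ∀ j, X j ⟶ M) (π : ∀ j, M ⟶ X j), ∀ a (x : M.obj a), ∃ s : Finset J,
      x = ∑ j ∈ s, ev (i j) a (ev (π j) a x) := by
  obtain ⟨i, hi⟩ := h
  let E : ∀ a, (DirectSum J fun j => (X j).obj a) ≃ₗ[k] M.obj a := fun a =>
    LinearEquiv.ofBijective (DirectSum.toModule k J (M.obj a) fun j => ev (i j) a) (hi a)
  have hE : ∀ a j (z : (X j).obj a), E a (DirectSum.lof k J _ j z) = ev (i j) a z :=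
    fun a j z => (LinearEquiv.ofBijective_apply _ _).trans
      (DirectSum.toModule_lof k (φ := fun j => ev (i j) a) j z)
  -- The pointwise decompositions commute with structure maps, so that their components are
  -- morphisms of modules.
  have hnat : ∀ a b (hab : a ≤ b) y,
      str M hab (E a y) = E b (DirectSum.lmap (fun j => str (X j) hab) y) := by
    intro a b hab y
    suffices h : str M hab ∘ₗ (E a).toLinearMap =
        (E b).toLinearMap ∘ₗ DirectSum.lmap (fun j => str (X j) hab) from
      LinearMap.congr_fun h y
    refine DirectSum.linearMap_ext _ fun j => LinearMap.ext fun z => ?_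
    simp only [LinearMap.comp_apply, LinearEquiv.coe_coe, DirectSum.lmap_lof, hE, ev_str]
  refine ⟨i, fun j => homMk (fun a => DirectSum.component k J _ j ∘ₗ (E a).symm.toLinearMap) ?_,
    fun a x => ⟨((E a).symm x).support, ?_⟩⟩
  · intro a b hab x
    obtain ⟨y, rfl⟩ := (E a).surjective x
    simp only [LinearMap.comp_apply, LinearEquiv.coe_coe, hnat, LinearEquiv.symm_apply_apply]
    rfl
  · obtain ⟨y, rfl⟩ := (E a).surjective x
    conv_lhs => rw [← DirectSum.sum_support_of y]
    rw [map_sum, LinearEquiv.symm_apply_apply]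
    refine Finset.sum_congr rfl fun j _ => ?_
    rw [ev_homMk, LinearMap.comp_apply, LinearEquiv.coe_coe, LinearEquiv.symm_apply_apply]
    exact hE a j _

/-! ### Small rigid modules -/

/-- In dimension at least two there is an antichain `x` of `m + 1` points with an upper bound `p`,
and a point `y` not far above, such that these properties persist under small diagonal shifts. -/
theorem exists_points (hn : 2 ≤ n) (m : ℕ) {s : ℝ≥0} (hs : 0 < s) :
    ∃ (x : Fin (m + 1) → RPoset n) (p y : RPoset n) (δ : ℝ≥0), 0 < δ ∧ (∀ i, x i ≤ p) ∧
      (∀ i, x i ≤ y) ∧ (∀ i, y ≤ diag s (diag s (x i))) ∧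
      (∀ t < δ, ¬ y ≤ diag t (diag t p)) ∧
      ∀ t < δ, ∀ i j, i ≠ j → ¬ x j ≤ diag t (diag t (x i)) := by
  obtain ⟨η, hη, hs'⟩ : ∃ η : ℝ, 0 < η ∧ (s : ℝ) = (m + 1) * η :=
    ⟨s / (m + 1), by positivity, by field_simp⟩
  have hi : ∀ i : Fin (m + 1), (i : ℝ) ≤ m := fun i => by
    exact_mod_cast Nat.lt_succ_iff.1 i.2
  have hi0 : ∀ i : Fin (m + 1), (0 : ℝ) ≤ i := fun i => by positivity
  obtain ⟨δ, hδ, hlt⟩ : ∃ δ : ℝ≥0, 0 < δ ∧ ∀ t < δ, (t : ℝ) + t < η :=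
    ⟨(η / 2).toNNReal, Real.toNNReal_pos.2 (half_pos hη), fun t ht => by
      have := Real.lt_toNNReal_iff_coe_lt.1 ht
      linarith⟩
  -- With `s = (m + 1)η`: `x i = (iη, -iη, 0, …)`, `p = (mη, 0, …)`, `y = (s, …, s)`. The relevant
  -- gaps are at least `η`, and `δ = η / 2` makes a double shift by `t < δ` shorter than `η`.
  refine ⟨fun i l => if l.1 = 0 then i * η else if l.1 = 1 then -(i * η) else 0,
    fun l => if l.1 = 0 then m * η else 0, fun _ => (m + 1) * η, δ, hδ, ?_, ?_, ?_, ?_, ?_⟩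
  · intro i l
    have := mul_le_mul_of_nonneg_right (hi i) hη.le
    have := mul_nonneg (hi0 i) hη.le
    dsimp only
    split_ifs <;> linarith
  · intro i l
    have := mul_le_mul_of_nonneg_right (hi i) hη.le
    have := mul_nonneg (hi0 i) hη.le
    dsimp only
    split_ifs <;> linarith
  · intro i l
    have := mul_le_mul_of_nonneg_right (hi i) hη.le
    have := mul_nonneg (hi0 i) hη.le
    simp only [diag, hs']
    split_ifs <;> linarith
  · intro t ht h
    have h0 := h ⟨0, by omega⟩
    have := hlt t ht
    simp only [diag, if_true] at h0
    linarith
  · intro t ht i j hij h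
    have h0 := h ⟨0, by omega⟩
    have h1 := h ⟨1, by omega⟩
    have := hlt t ht
    simp only [diag, if_true, one_ne_zero, if_false] at h0 h1
    -- Coordinate 0 excludes the inequality if `i < j`, coordinate 1 if `j < i`.
    rcases lt_or_gt_of_ne hij with hlt | hlt
    · have : (i : ℝ) + 1 ≤ j := by exact_mod_cast hlt
      nlinarith
    · have : (j : ℝ) + 1 ≤ i := by exact_mod_cast hlt
      nlinarith

/-- For `n ≥ 2` there are arbitrarily small finitely presentable modules with a subspace of
dimension `m` at some point `p` that survives small shifts, such that all morphisms to a small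
shift act at `p` as multiples of the structure map. -/
theorem exists_small_rigid (hn : 2 ≤ n) (m : ℕ) {s : ℝ≥0} (hs : 0 < s) :
    ∃ W : PersMod k n, W.IsFinPres ∧
      (∀ a (w : W.obj a), str W (le_diag_diag s a) w = 0) ∧
      ∃ δ : ℝ≥0, 0 < δ ∧ ∃ (p : RPoset n) (w : Fin m → W.obj p), ∀ t < δ,
        LinearIndependent k (fun i => str W (le_diag_diag t p) (w i)) ∧
        ∀ ψ : ∀ a, W.obj a →ₗ[k] W.obj (diag t (diag t a)),
          (∀ a b (h : a ≤ b) w, ψ b (str W h w) = str W (diag_diag_mono t h) (ψ a w)) →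
          ∃ c : k, ∀ w : W.obj p, ψ p w = c • str W (le_diag_diag t p) w := by
  obtain ⟨x, p, y, δ, hδ, hxp, hxy, hys, hyp, hx⟩ := exists_points hn m hs
  -- Relation 0 is `∑ g i = 0` at `p`; relation `i + 1` kills `g i` at `y`.
  obtain ⟨W, g, hfp, hspan, hrel, huniv⟩ := exists_isFinPres_of_relations x
    (Fin.cons p fun _ : Fin (m + 1) => y)
    (Fin.cons (fun _ => (1 : k)) fun i => Pi.single i 1)
  have hrelp : ∑ i, str W (hxp i) (g i) = 0 := by
    have h := hrel 0
    simp only [Fin.cons_zero, one_smul] at h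
    exact (Finset.sum_congr rfl fun i _ => (push_of_le W (hxp i) _).symm).trans h
  have hrely : ∀ i, str W (hxy i) (g i) = 0 := by
    intro i
    have h := hrel i.succ
    simp only [Fin.cons_succ, Pi.single_apply, ite_smul, one_smul, zero_smul,
      Finset.sum_ite_eq', Finset.mem_univ, if_true] at h
    exact (push_of_le W (hxy i) _).symm.trans h
  -- No further relations hold just above `p`: any values `l i` of sum zero extend to a functional,
  -- obtained by mapping `W` to the indicator module of the points not above `y`.
  have hval : ∀ l : Fin (m + 1) → k, ∑ i, l i = 0 → ∀ t < δ,
      ∃ φ : W.obj (diag t (diag t p)) →ₗ[k] k,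
        ∀ i, φ (str W ((hxp i).trans (le_diag_diag t p)) (g i)) = l i := by
    intro l hl t ht
    let S : Set (RPoset n) := (Set.Ici y)ᶜ
    have hS : S.OrdConnected := (isUpperSet_Ici y).compl.ordConnected
    have hpS : diag t (diag t p) ∈ S := hyp t ht
    have hp : p ∈ S := fun h => hpS (le_trans h (le_diag_diag t p))
    let v : ∀ i, (indicatorModule k S hS).obj (x i) := fun i =>
      (⟨l i, fun h => (h fun h' => hp (le_trans h' (hxp i))).elim⟩ : indicatorValue k S (x i))
    have hv : ∀ i, indVal (v i) = l i := fun i => rfl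
    obtain ⟨h, hh⟩ := huniv (indicatorModule k S hS) v (by
      intro j
      refine Fin.cases ?_ (fun i => ?_) j
      · apply indVal_injective
        simp only [Fin.cons_zero, one_smul, map_sum, map_zero]
        rw [← hl]
        refine Finset.sum_congr rfl fun i _ => ?_
        rw [← hv i, ← indVal_str (hxp i) hp]
        exact congrArg _ (push_of_le _ (hxp i) _)
      · apply indVal_injective
        rw [map_zero]
        exact indVal_eq_zero (fun h : y ∈ S => h (Set.mem_Ici.2 le_rfl)) _)
    refine ⟨indVal ∘ₗ ev h _, fun i => ?_⟩
    rw [LinearMap.comp_apply, ev_str, hh, indVal_str _ hpS, hv]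
  have hind : ∀ t < δ, ∀ c : Fin (m + 1) → k,
      ∑ i, c i • str W ((hxp i).trans (le_diag_diag t p)) (g i) = 0 → ∀ i, c i = c 0 := by
    intro t ht c hc i
    -- Testing with the functional `e_i - e_0` compares `c i` with `c 0`.
    obtain ⟨φ, hφ⟩ := hval (Pi.single i 1 - Pi.single 0 1) (by simp) t ht
    have h := congrArg φ hc
    simp only [map_sum, map_smul, hφ, map_zero, smul_eq_mul, Pi.sub_apply, mul_sub,
      Finset.sum_sub_distrib, Pi.single_apply, mul_ite, mul_one, mul_zero, Finset.sum_ite_eq',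
      Finset.mem_univ, if_true] at h
    exact sub_eq_zero.1 h
  -- Omitting `g 0` leaves `m` independent vectors: a relation among them has coefficient zero at `g
  -- 0`, hence everywhere.
  refine ⟨W, hfp, ?_, δ, hδ, p, fun i => str W (hxp i.succ) (g i.succ), fun t ht => ⟨?_, ?_⟩⟩
  · intro a w
    obtain ⟨c, rfl⟩ := hspan a w
    rw [map_sum]
    refine Finset.sum_eq_zero fun i _ => ?_
    by_cases h : x i ≤ a
    · rw [push_of_le W h, map_smul, str_str,
        ← str_str W (hxy i) ((hys i).trans (diag_diag_mono s h)), hrely, map_zero, smul_zero]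
    · rw [push_of_not_le W h, smul_zero, map_zero]
  · rw [Fintype.linearIndependent_iff]
    intro c hc i
    have h := hind t ht (Fin.cons 0 c) (by
      rw [Fin.sum_univ_succ]
      simpa [str_str] using hc) i.succ
    simpa using h
  · intro ψ hψ
    have hc : ∀ i, ∃ c : k, ψ (x i) (g i) = c • str W (le_diag_diag t (x i)) (g i) := by
      intro i
      obtain ⟨c, hc⟩ := hspan _ (ψ (x i) (g i))
      refine ⟨c i, hc.trans ?_⟩
      -- By the antichain property, no other generator lies below `x i + 2t`.
      rw [Finset.sum_eq_single i, push_of_le W (le_diag_diag t (x i))]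
      · intro j _ hj
        rw [push_of_not_le W (hx t ht i j hj.symm), smul_zero]
      · simp
    choose c hc using hc
    have hψg : ∀ i, ψ p (str W (hxp i) (g i)) =
        c i • str W ((hxp i).trans (le_diag_diag t p)) (g i) := fun i => by
      rw [hψ, hc, map_smul, str_str]
    -- Applying `ψ` to `∑ g i = 0` gives a relation with coefficients `c i`, which must then be
    -- equal.
    have hc0 := hind t ht c (by
      simp only [← hψg]
      rw [← map_sum, hrelp, map_zero])
    refine ⟨c 0, fun w => ?_⟩
    obtain ⟨d, rfl⟩ := hspan p w
    rw [map_sum, map_sum, Finset.smul_sum]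
    refine Finset.sum_congr rfl fun i _ => ?_
    rw [push_of_le W (hxp i), map_smul, map_smul, hψg, hc0, str_str, smul_comm]

/-! ### Perturbation by a rigid summand -/

/-- For `n ≥ 2`, every finitely presentable module has arbitrarily close finitely presentable
modules `N` such that no module close to `N` is a direct sum of modules of pointwise dimension at
most `d`. -/
theorem exists_near_not_isDirectSumOf (hn : 2 ≤ n) (d : ℕ) {M : PersMod k n} (hM : M.IsFinPres)
    {s : ℝ≥0} (hs : 0 < s) :
    ∃ N : PersMod k n, N.IsFinPres ∧ Interleaved s M N ∧ ∃ δ : ℝ≥0, 0 < δ ∧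
      ∀ t < δ, ∀ L : PersMod k n, Interleaved t N L → ∀ (J : Type) (X : J → PersMod k n),
        (∀ j p, Module.finrank k ((X j).obj p) ≤ d) → ¬ IsDirectSumOf X L := by
  obtain ⟨W, hfp, hsmall, δ, hδ, p, w, hw⟩ := exists_small_rigid (k := k) hn (d + 1) hs
  refine ⟨M ⊞ W, hM.biprod hfp, Interleaved.biprod_of_str_eq_zero M hsmall, δ, hδ, ?_⟩
  intro t ht L hL J X hX hsum
  obtain ⟨f, g, hf, hg, hfg, -⟩ := interleaved_iff.1 hL
  obtain ⟨i, π, hπ⟩ := hsum.exists_proj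
  obtain ⟨hind, hend⟩ := hw t ht
  let F : ∀ a, W.obj a →ₗ[k] L.obj (diag t a) := fun a => f a ∘ₗ ev biprod.inr a
  let G : ∀ a, L.obj a →ₗ[k] W.obj (diag t a) := fun a => ev biprod.snd _ ∘ₗ g a
  have hF : ∀ a b (h : a ≤ b) x, F b (str W h x) = str L (diag_mono t h) (F a x) :=
    fun a b h x => by simp only [F, LinearMap.comp_apply, ev_str, hf]
  have hG : ∀ a b (h : a ≤ b) x, G b (str L h x) = str W (diag_mono t h) (G a x) :=
    fun a b h x => by simp only [G, LinearMap.comp_apply, ev_str, hg]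
  have hFG : ∀ a x, G (diag t a) (F a x) = str W (le_diag_diag t a) x := fun a x => by
    simp only [F, G, LinearMap.comp_apply, hfg, ev_str]
    rw [← ev_comp, biprod.inr_snd, ev_id]
  -- Rigidity applied to the part of the round trip `W → L → W` that passes through `X j`.
  have hscal : ∀ j, ∃ c : k, ∀ x : W.obj p,
      G _ (ev (i j) _ (ev (π j) _ (F p x))) = c • str W (le_diag_diag t p) x := fun j =>
    hend (fun a => G _ ∘ₗ ev (i j) _ ∘ₗ ev (π j) _ ∘ₗ F a) fun a b h x => by
      simp only [LinearMap.comp_apply, ev_str, hF, hG]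
  choose c hc using hscal
  -- If all scalars were zero, the structure map would kill `w 0`, although its image belongs to an
  -- independent family.
  obtain ⟨j, hj⟩ : ∃ j, c j ≠ 0 := by
    by_contra! hzero
    refine hind.ne_zero 0 ?_
    obtain ⟨σ, hσ⟩ := hπ _ (F p (w 0))
    rw [← hFG, hσ, map_sum]
    exact Finset.sum_eq_zero fun j _ => by rw [hc, hzero, zero_smul]
  -- The images in `X j` are independent because mapping them back to `W` gives an independent
  -- family scaled by `c j`.
  have hli : LinearIndependent k fun l => ev (π j) _ (F p (w l)) := by
    refine LinearIndependent.of_comp (G _ ∘ₗ ev (i j) _) ?_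
    convert hind.units_smul fun _ => Units.mk0 (c j) hj using 1
    funext l
    exact hc j (w l)
  have h := hli.fintype_card_le_finrank
  rw [Fintype.card_fin] at h
  exact absurd (hX j (diag t p)) (by omega)

theorem finrank_indicatorModule_le (S : Set (RPoset n)) (hS : S.OrdConnected) (p : RPoset n) :
    Module.finrank k ((indicatorModule k S hS).obj p) ≤ 1 :=
  (Submodule.finrank_le (indicatorValue k S p)).trans (Module.finrank_self k).le

end PersMod

/-! ### Topology of the interleaving distance -/

namespace FPSpace

variable {k : Type u} [Field k] {n : ℕ}

theorem dist_self (x : FPSpace k n) : dist x x = 0 :=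
  Quotient.inductionOn x fun M => PersMod.interleavingDist_self M.1

theorem dist_triangle (x y z : FPSpace k n) : dist x z ≤ dist x y + dist y z :=
  Quotient.inductionOn₃ x y z fun M N L => PersMod.interleavingDist_triangle M.1 N.1 L.1

theorem isOpen_ball (x : FPSpace k n) {ε : ℝ} (hε : 0 < ε) :
    IsOpen {y | dist x y < ENNReal.ofReal ε} :=
  TopologicalSpace.isOpen_generateFrom_of_mem ⟨x, ε, hε, rfl⟩

/-- Open sets contain a ball around each of their points. -/
theorem exists_ball_subset {U : Set (FPSpace k n)} (hU : IsOpen U) {x : FPSpace k n}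
    (hx : x ∈ U) : ∃ s : ℝ≥0, 0 < s ∧ ∀ y, dist x y ≤ s → y ∈ U := by
  induction hU with
  | basic B hB =>
    obtain ⟨z, ε, hε, rfl⟩ := hB
    obtain ⟨s, hs, hlt⟩ := ENNReal.lt_iff_exists_add_pos_lt.1 (show dist z x < _ from hx)
    exact ⟨s, hs, fun y hy => ((dist_triangle z x y).trans (add_le_add_right hy _)).trans_lt hlt⟩
  | univ => exact ⟨1, one_pos, fun _ _ => trivial⟩
  | inter A B _ _ ihA ihB =>
    obtain ⟨s, hs, hA⟩ := ihA hx.1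
    obtain ⟨s', hs', hB⟩ := ihB hx.2
    refine ⟨min s s', lt_min hs hs', fun y hy => ⟨hA y (hy.trans ?_), hB y (hy.trans ?_)⟩⟩
    · exact_mod_cast min_le_left s s'
    · exact_mod_cast min_le_right s s'
  | sUnion S _ ih =>
    obtain ⟨A, hA, hxA⟩ := hx
    obtain ⟨s, hs, h⟩ := ih A hA hxA
    exact ⟨s, hs, fun y hy => ⟨A, hA, h y hy⟩⟩

/-- For `n ≥ 2`, the direct sums of modules of bounded pointwise dimension are nowhere dense. -/
theorem isNowhereDense_of_bounded (hn : 2 ≤ n) (d : ℕ) {D : Set (FPSpace k n)}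
    (hD : ∀ x ∈ D, ∃ M : FPMod k n, mk M = x ∧ ∃ (J : Type) (X : J → PersMod k n),
      (∀ j p, Module.finrank k ((X j).obj p) ≤ d) ∧ PersMod.IsDirectSumOf X M.1) :
    IsNowhereDense D := by
  rw [IsNowhereDense, Set.eq_empty_iff_forall_notMem]
  intro x hx
  obtain ⟨s, hs, hball⟩ := exists_ball_subset isOpen_interior hx
  induction x using Quotient.inductionOn with | h M => ?_
  obtain ⟨N, hN, hMN, δ, hδ, hfar⟩ := PersMod.exists_near_not_isDirectSumOf hn d M.2 hs
  -- The perturbation stays in the interior of the closure, so each ball around `N` must meet `D`;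
  -- the ball of radius `δ` does not.
  have hcl : mk ⟨N, hN⟩ ∈ closure D := interior_subset (hball _ (iInf₂_le s hMN))
  have hδ' : (0 : ℝ) < δ := hδ
  obtain ⟨y, hy, hyD⟩ := mem_closure_iff.1 hcl _ (isOpen_ball (mk ⟨N, hN⟩) hδ') (by
    rw [Set.mem_ofPred_eq, dist_self]
    exact ENNReal.ofReal_pos.2 hδ')
  obtain ⟨L, rfl, J, X, hX, hsum⟩ := hD y hyD
  rw [Set.mem_ofPred_eq, ENNReal.ofReal_coe_nnreal] at hy
  obtain ⟨t, ht, hNL⟩ := PersMod.exists_interleaved_of_dist_lt (M := N) (N := L.1) hy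
  exact hfar t ht L.1 hNL J X hX hsum

end FPSpace

end

theorem mainTheorem6 {k : Type*} [Field k] {n : ℕ} (hn : 2 ≤ n) :
    (∀ F : Set (FPSpace k n), FPSpace.AllIndecomposable F →
      ¬ FPSpace.HasArbitrarilyHighPointwiseDim F →
      IsNowhereDense (FPSpace.decomposables F)) ∧
    IsNowhereDense (FPSpace.spreadDecomposables k n) := by
  refine ⟨fun F _ hF => ?_, ?_⟩
  · simp only [FPSpace.HasArbitrarilyHighPointwiseDim, not_forall, not_exists, not_and,
      not_le] at hF
    obtain ⟨d, hd⟩ := hF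
    refine FPSpace.isNowhereDense_of_bounded hn d ?_
    rintro x ⟨M, hM, J, X, hX, hsum⟩
    exact ⟨M, hM, J, _, fun j p => (hd (X j) (hX j) p).le, hsum⟩
  · refine FPSpace.isNowhereDense_of_bounded hn 1 ?_
    rintro x ⟨M, hM, J, S, hS, hsum⟩
    exact ⟨M, hM, J, _, fun j p => PersMod.finrank_indicatorModule_le _ _ p, hsum⟩
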